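/- A directed graph is a set of vertices with an irreflexive binary relation on it, and a graph is a set of vertices with an irreflexive symmetric binary relation on it. Let $D$ be the countable universal directed graph, that is, the Fraïssé limit of the class of finite directed graphs, and let $\operatorname{End} D$ be its endomorphism monoid (all maps from the vertex set to itself that send edges to edges; maps are written on the right, so that $fg$ is $f$ followed by $g$). In a monoid $M$, let $f \mathrel{\mathscr{L}} g$ mean $Mf = Mg$, let $f \mathrel{\mathscr{R}} g$ mean $fM = gM$, and put $\mathscr{H} = \mathscr{L} \cap \mathscr{R}$ and $\mathscr{D} = \mathscr{L} \circ \mathscr{R}$; a $\mathscr{D}$-class is non-regular if no element $f$ of it satisfies $fgf = f$ for some $g \in M$. The Schützenberger group of an $\mathscr{H}$-class $H$ of $M$ is the group of permutations of $H$ of the form $h \mapsto ht$, where $t \in M$ satisfies $Ht \subseteq H$. Theorem. Let $\Gamma$ be any countable (finite or countably infinite, undirected) graph. Then the set of those non-regular $\mathscr{D}$-classes of $\operatorname{End} D$ for which every $\mathscr{H}$-class contained in the $\mathscr{D}$-class has Schützenberger group isomorphic to $\operatorname{Aut} \Gamma$ has cardinality exactly $2^{\aleph_0}$. -/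

import Mathlib

universe u v

open scoped Cardinal

/-! ### Green's relations and the Schützenberger group of a monoid -/

namespace Green

variable {M : Type u} [Monoid M]

/-- `f` and `g` are `L`-related: they generate the same left ideal, `M f = M g`. -/
def RelL (f g : M) : Prop := Set.range (fun m : M => m * f) = Set.range (fun m : M => m * g)

/-- `f` and `g` are `R`-related: they generate the same right ideal, `f M = g M`. -/
def RelR (f g : M) : Prop := Set.range (fun m : M => f * m) = Set.range (fun m : M => g * m)

/-- `H` is the intersection of `L` and `R`. -/
def RelH (f g : M) : Prop := RelL f g ∧ RelR f g

/-- `D` is the composite `L ∘ R`. -/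
def RelD (f g : M) : Prop := ∃ h : M, RelL f h ∧ RelR h g

/-- A set is a `D`-class if it is the set of all elements `D`-related to some element. -/
def IsDClass (C : Set M) : Prop := ∃ f : M, C = {g | RelD f g}

/-- The `H`-class of `f`. -/
def hClass (f : M) : Set M := {h | RelH f h}

/-- An element `f` is regular if `f g f = f` for some `g`. -/
def Regular (f : M) : Prop := ∃ g : M, f * g * f = f

/-- The set `T_H` of all `t` with `H t ⊆ H`, where `H` is the `H`-class of `f`. -/
def stab (f : M) : Set M := {t | ∀ h ∈ hClass f, h * t ∈ hClass f}

theorem relL_iff {f g : M} : RelL f g ↔ (∃ a, a * g = f) ∧ ∃ b, b * f = g := by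
  constructor
  · intro h
    unfold RelL at h
    refine ⟨?_, ?_⟩
    · have : f ∈ Set.range (fun m : M => m * f) := ⟨1, one_mul f⟩
      rw [h] at this
      exact this
    · have : g ∈ Set.range (fun m : M => m * g) := ⟨1, one_mul g⟩
      rw [← h] at this
      exact this
  · rintro ⟨⟨a, ha⟩, b, hb⟩
    apply Set.Subset.antisymm
    · rintro _ ⟨m, rfl⟩
      exact ⟨m * a, by simp only [mul_assoc, ha]⟩
    · rintro _ ⟨m, rfl⟩
      exact ⟨m * b, by simp only [mul_assoc, hb]⟩

theorem relR_iff {f g : M} : RelR f g ↔ (∃ a, g * a = f) ∧ ∃ b, f * b = g := by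
  constructor
  · intro h
    unfold RelR at h
    refine ⟨?_, ?_⟩
    · have : f ∈ Set.range (fun m : M => f * m) := ⟨1, mul_one f⟩
      rw [h] at this
      exact this
    · have : g ∈ Set.range (fun m : M => g * m) := ⟨1, mul_one g⟩
      rw [← h] at this
      exact this
  · rintro ⟨⟨a, ha⟩, b, hb⟩
    apply Set.Subset.antisymm
    · rintro _ ⟨m, rfl⟩
      exact ⟨a * m, by simp only [← mul_assoc, ha]⟩
    · rintro _ ⟨m, rfl⟩
      exact ⟨b * m, by simp only [← mul_assoc, hb]⟩

theorem mem_hClass_self (f : M) : f ∈ hClass f := ⟨rfl, rfl⟩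

/-- Every `t ∈ T_H` has a companion `s ∈ T_H` such that right multiplication by `s` inverts right
multiplication by `t` on `H`. -/
theorem exists_inverse {f t : M} (ht : t ∈ stab f) :
    ∃ s ∈ stab f, (∀ h ∈ hClass f, h * t * s = h) ∧ ∀ h ∈ hClass f, h * s * t = h := by
  have hft : f * t ∈ hClass f := ht f (mem_hClass_self f)
  obtain ⟨s, hs⟩ := (relR_iff.1 hft.2).1
  have key : ∀ h ∈ hClass f, h * t * s = h := by
    intro h hh
    obtain ⟨b, hb⟩ := (relL_iff.1 hh.1).2
    rw [← hb, mul_assoc b f t, mul_assoc b, hs]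
  have key2 : ∀ h ∈ hClass f, h * s * t = h := by
    intro h hh
    have hL : RelL (f * t) h := hft.1.symm.trans hh.1
    obtain ⟨b, hb⟩ := (relL_iff.1 hL).2
    rw [← hb, mul_assoc b, hs, mul_assoc]
  refine ⟨s, ?_, key, key2⟩
  intro h hh
  have hL : RelL (f * t) h := hft.1.symm.trans hh.1
  obtain ⟨⟨a, ha⟩, b, hb⟩ := relL_iff.1 hL
  refine ⟨relL_iff.2 ⟨⟨a, ?_⟩, b, ?_⟩, hh.2.trans (relR_iff.2 ⟨⟨t, key2 h hh⟩, s, rfl⟩)⟩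
  · rw [← mul_assoc, ha, hs]
  · rw [← hb, mul_assoc b, hs]

/-- For `t ∈ T_H`, the permutation `γ_t : h ↦ h t` of the `H`-class `H` of `f`. -/
noncomputable def gamma (f : M) (t : stab f) : Equiv.Perm (hClass f) :=
  Equiv.ofBijective (fun h => ⟨h.1 * t.1, t.2 h.1 h.2⟩) (by
    obtain ⟨s, hs, h1, h2⟩ := exists_inverse t.2
    constructor
    · intro x y hxy
      have hxy' : x.1 * t.1 = y.1 * t.1 := congrArg Subtype.val hxy
      apply Subtype.ext
      rw [← h1 x.1 x.2, hxy', h1 y.1 y.2]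
    · intro y
      exact ⟨⟨y.1 * s, hs y.1 y.2⟩, Subtype.ext (h2 y.1 y.2)⟩)

@[simp] theorem gamma_coe (f : M) (t : stab f) (h : hClass f) :
    (gamma f t h : M) = h.1 * t.1 := rfl

/-- The Schützenberger group `{γ_t : t ∈ T_H}` of the `H`-class `H` of `f`, as a group of
permutations of `H`. -/
noncomputable def schutzenbergerGroup (f : M) : Subgroup (Equiv.Perm (hClass f)) where
  carrier := Set.range (gamma f)
  one_mem' := ⟨⟨1, fun h hh => by simpa using hh⟩, by ext h; simp⟩
  mul_mem' := by
    rintro _ _ ⟨s, rfl⟩ ⟨t, rfl⟩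
    refine ⟨⟨t.1 * s.1, fun h hh => ?_⟩, ?_⟩
    · rw [← mul_assoc]
      exact s.2 _ (t.2 h hh)
    · ext h
      simp [mul_assoc]
  inv_mem' := by
    rintro _ ⟨t, rfl⟩
    obtain ⟨s, hs, h1, _⟩ := exists_inverse t.2
    refine ⟨⟨s, hs⟩, ?_⟩
    rw [eq_inv_iff_mul_eq_one]
    ext h
    simp [h1 h.1 h.2]

end Green

/-! ### The countable universal directed graph -/

namespace Digraph

/-- A digraph as a first-order structure with one binary relation. -/
@[reducible] def toStructure {V : Type u} (G : Digraph V) : FirstOrder.Language.graph.Structure V where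
  RelMap | .adj => fun x => G.Adj (x 0) (x 1)

/-- The class of finite directed graphs: finite structures with one irreflexive binary relation. -/
def finiteDigraphs : Set (CategoryTheory.Bundled.{u} FirstOrder.Language.graph.Structure) :=
  {A | Finite A ∧ ∀ a : A, ¬ FirstOrder.Language.Structure.RelMap FirstOrder.Language.adj ![a, a]}

/-- `D` is (a copy of) the countable universal directed graph: the Fraïssé limit of the class of
finite directed graphs. -/
def IsCountableUniversal {V : Type u} (D : Digraph V) : Prop :=
  ∃ _ : Countable V,
    letI := D.toStructure
    FirstOrder.Language.IsFraisseLimit finiteDigraphs.{u} V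

/-- The endomorphism monoid of a directed graph. Maps act on the right, that is, the product
`f * g` is `f` followed by `g`; this is the opposite of the multiplication on `D.Adj →r D.Adj`. -/
abbrev EndMonoid {V : Type u} (D : Digraph V) : Type u := (D.Adj →r D.Adj)ᵐᵒᵖ

end Digraph

/-! An injective endomorphism `f` of `D` amounts to a pair of relations on the vertices: the edges
of `D`, and the larger set of pairs that `f` sends to edges. `D`-related injective endomorphisms
give isomorphic pairs (`exists_equiv_of_relD`), and each `f * t` in the `H`-class of `f` induces an
automorphism of the pair (`exists_equiv_of_mem_hClass`). If the second relation is strictly larger,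
`f` is not regular. So it suffices to find continuum many non-isomorphic pairs with automorphism
group `Aut Γ`, whose automorphisms are all induced by right multiplication.

The base is `Γ` with a copy of `ω` placed below it: it is infinite and has the automorphisms of `Γ`
(`rayRel_aut`). Over it, vertices with arbitrary finite sets of in- and out-neighbours are added
freely, level by level. The result has the extension property, so it is a copy of `D` by back and
forth. The second relation `Rel'` adds all pairs that drop in level, and makes level `n + 1`
complete for `n ∈ S`. An added pair that is not added in reverse must drop in level, so the pair of
relations determines the levels (`lev_eq_of_iso`), hence `S` (`eq_of_iso`) and the base. A vertex of
positive level is determined by its level and its earlier neighbours, so an automorphism is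
determined by its action on the base (`exists_act`).

The free construction over `Rel'` is again a copy of `D`, which makes the inclusion an endomorphism,
and automorphisms of its base extend to it, which provides the right multipliers. Green's lemma
carries the Schützenberger group through the `D`-class. The upper bound holds because a countable
set has at most continuum many self-maps. -/

namespace Green

/-! ### Invariance of regularity and of the Schützenberger group under `D`. -/

variable {M : Type u} [Monoid M]

theorem RelL.symm {f g : M} (h : RelL f g) : RelL g f := Eq.symm h

theorem RelR.symm {f g : M} (h : RelR f g) : RelR g f := Eq.symm h

theorem RelL.regular {f h : M} (hL : RelL f h) (hf : Regular f) : Regular h := by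
  obtain ⟨⟨a, ha⟩, b, hb⟩ := relL_iff.1 hL
  obtain ⟨g, hg⟩ := hf
  refine ⟨g * a, ?_⟩
  rw [mul_assoc, mul_assoc, ha, ← hb, mul_assoc, ← mul_assoc f, hg]

theorem RelR.regular {f h : M} (hR : RelR f h) (hf : Regular f) : Regular h := by
  obtain ⟨⟨a, ha⟩, b, hb⟩ := relR_iff.1 hR
  obtain ⟨g, hg⟩ := hf
  refine ⟨a * g, ?_⟩
  rw [← mul_assoc, ha, ← hb, ← mul_assoc, hg]

theorem RelD.regular {f g : M} (h : RelD f g) (hg : Regular g) : Regular f := by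
  obtain ⟨k, hL, hR⟩ := h
  exact hL.symm.regular (hR.symm.regular hg)

/-- An equivalence of `H`-classes which intertwines the two families of right translations
induces an isomorphism of the Schützenberger groups. -/
theorem nonempty_mulEquiv_of_intertwine {f g : M} (φ : hClass f ≃ hClass g)
    (h₁ : ∀ t : stab f, ∃ s : stab g, ∀ x, φ (gamma f t x) = gamma g s (φ x))
    (h₂ : ∀ s : stab g, ∃ t : stab f, ∀ x, φ (gamma f t x) = gamma g s (φ x)) :
    Nonempty (schutzenbergerGroup f ≃* schutzenbergerGroup g) := by
  have key : (schutzenbergerGroup f).map (φ.permCongrHom : _ →* Equiv.Perm (hClass g)) =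
      schutzenbergerGroup g := by
    ext p
    constructor
    · rintro ⟨_, ⟨t, rfl⟩, rfl⟩
      obtain ⟨s, hs⟩ := h₁ t
      refine ⟨s, ?_⟩
      ext x : 1
      simpa using (hs (φ.symm x)).symm
    · rintro ⟨s, rfl⟩
      obtain ⟨t, ht⟩ := h₂ s
      refine ⟨gamma f t, ⟨t, rfl⟩, ?_⟩
      ext x : 1
      simpa using ht (φ.symm x)
  exact ⟨((φ.permCongrHom).subgroupMap (schutzenbergerGroup f)).trans
    (MulEquiv.subgroupCongr key)⟩

theorem RelL.mul_right {f g : M} (h : RelL f g) (t : M) : RelL (f * t) (g * t) := by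
  obtain ⟨⟨a, ha⟩, b, hb⟩ := relL_iff.1 h
  exact relL_iff.2 ⟨⟨a, by rw [← mul_assoc, ha]⟩, b, by rw [← mul_assoc, hb]⟩

theorem RelR.mul_left {f g : M} (h : RelR f g) (t : M) : RelR (t * f) (t * g) := by
  obtain ⟨⟨a, ha⟩, b, hb⟩ := relR_iff.1 h
  exact relR_iff.2 ⟨⟨a, by rw [mul_assoc, ha]⟩, b, by rw [mul_assoc, hb]⟩

/-- Green's lemma: the multiplier that takes `f` to `g` takes the whole `H`-class along, since each
`x` in it is a right multiple of `f`. -/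
theorem mul_left_mem_hClass {f g b x : M} (hb : b * f = g) (hL : RelL f g)
    (hx : x ∈ hClass f) : b * x ∈ hClass g := by
  refine ⟨?_, ?_⟩
  · obtain ⟨a, ha⟩ := (relL_iff.1 hL).1
    obtain ⟨s, hs⟩ := (relR_iff.1 hx.2).2
    have hxx : a * (b * x) = x := by
      rw [← hs, ← mul_assoc b, hb, ← mul_assoc, ha]
    have : RelL x (b * x) := relL_iff.2 ⟨⟨a, hxx⟩, b, rfl⟩
    exact (hL.symm.trans hx.1).trans this
  · have := hx.2.mul_left b
    rwa [hb] at this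

theorem mul_right_mem_hClass {f g b x : M} (hb : f * b = g) (hR : RelR f g)
    (hx : x ∈ hClass f) : x * b ∈ hClass g := by
  refine ⟨?_, ?_⟩
  · have := hx.1.mul_right b
    rwa [hb] at this
  · obtain ⟨a, ha⟩ := (relR_iff.1 hR).1
    obtain ⟨s, hs⟩ := (relL_iff.1 hx.1).2
    have hxx : x * b * a = x := by
      rw [← hs, mul_assoc s, hb, mul_assoc, ha]
    have : RelR x (x * b) := relR_iff.2 ⟨⟨a, hxx⟩, b, rfl⟩
    exact (hR.symm.trans hx.2).trans this

theorem mul_mul_cancel_left {f a b x : M} (hab : a * (b * f) = f) (hx : x ∈ hClass f) :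
    a * (b * x) = x := by
  obtain ⟨s, hs⟩ := (relR_iff.1 hx.2).2
  rw [← hs, ← mul_assoc b, ← mul_assoc, hab]

theorem mul_mul_cancel_right {f a b x : M} (hab : f * b * a = f) (hx : x ∈ hClass f) :
    x * b * a = x := by
  obtain ⟨s, hs⟩ := (relL_iff.1 hx.1).2
  rw [← hs, mul_assoc s, mul_assoc, hab]

theorem RelL.schutzenbergerGroup {f g : M} (h : RelL f g) :
    Nonempty (schutzenbergerGroup f ≃* schutzenbergerGroup g) := by
  obtain ⟨⟨a, ha⟩, b, hb⟩ := relL_iff.1 h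
  have hf : a * (b * f) = f := by rw [hb, ha]
  have hg : b * (a * g) = g := by rw [ha, hb]
  let φ : hClass f ≃ hClass g :=
    { toFun := fun x => ⟨b * x, mul_left_mem_hClass hb h x.2⟩
      invFun := fun x => ⟨a * x, mul_left_mem_hClass ha h.symm x.2⟩
      left_inv := fun x => Subtype.ext (mul_mul_cancel_left hf x.2)
      right_inv := fun x => Subtype.ext (mul_mul_cancel_left hg x.2) }
  -- Left multiplication commutes with right translation, so the same `t` serves on both sides.
  refine nonempty_mulEquiv_of_intertwine φ (fun t => ⟨⟨t.1, fun x hx => ?_⟩, fun x => ?_⟩)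
    (fun t => ⟨⟨t.1, fun x hx => ?_⟩, fun x => ?_⟩)
  · have := mul_left_mem_hClass hb h (t.2 _ (mul_left_mem_hClass ha h.symm hx))
    rwa [← mul_assoc, mul_mul_cancel_left hg hx] at this
  · exact Subtype.ext (mul_assoc _ _ _).symm
  · have := mul_left_mem_hClass ha h.symm (t.2 _ (mul_left_mem_hClass hb h hx))
    rwa [← mul_assoc, mul_mul_cancel_left hf hx] at this
  · exact Subtype.ext (mul_assoc _ _ _).symm

theorem RelR.schutzenbergerGroup {f g : M} (h : RelR f g) :
    Nonempty (schutzenbergerGroup f ≃* schutzenbergerGroup g) := by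
  obtain ⟨⟨a, ha⟩, b, hb⟩ := relR_iff.1 h
  have hf : f * b * a = f := by rw [hb, ha]
  have hg : g * a * b = g := by rw [ha, hb]
  let φ : hClass f ≃ hClass g :=
    { toFun := fun x => ⟨x * b, mul_right_mem_hClass hb h x.2⟩
      invFun := fun x => ⟨x * a, mul_right_mem_hClass ha h.symm x.2⟩
      left_inv := fun x => Subtype.ext (mul_mul_cancel_right hf x.2)
      right_inv := fun x => Subtype.ext (mul_mul_cancel_right hg x.2) }
  -- Here translations have to be conjugated: return to the first class by `a`, apply `t`, go over
  -- again by `b`.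
  refine nonempty_mulEquiv_of_intertwine φ (fun t => ⟨⟨a * t.1 * b, fun x hx => ?_⟩, fun x => ?_⟩)
    (fun t => ⟨⟨b * t.1 * a, fun x hx => ?_⟩, fun x => Subtype.ext ?_⟩)
  · have := mul_right_mem_hClass hb h (t.2 _ (mul_right_mem_hClass ha h.symm hx))
    simpa only [mul_assoc] using this
  · refine Subtype.ext ?_
    change x.1 * t.1 * b = x.1 * b * (a * t.1 * b)
    rw [← mul_assoc, ← mul_assoc, mul_mul_cancel_right hf x.2]
  · have := mul_right_mem_hClass ha h.symm (t.2 _ (mul_right_mem_hClass hb h hx))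
    simpa only [mul_assoc] using this
  · have := mul_mul_cancel_right hg (t.2 _ (mul_right_mem_hClass hb h x.2))
    change x.1 * (b * t.1 * a) * b = x.1 * b * t.1
    simpa only [mul_assoc] using this

theorem RelD.schutzenbergerGroup {f g : M} (h : RelD f g) :
    Nonempty (schutzenbergerGroup f ≃* schutzenbergerGroup g) := by
  obtain ⟨k, hL, hR⟩ := h
  obtain ⟨e⟩ := RelL.schutzenbergerGroup hL
  obtain ⟨e'⟩ := RelR.schutzenbergerGroup hR
  exact ⟨e.trans e'⟩

/-- A group acting faithfully on the right of `f` inside its `H`-class, and reaching every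
translate of `f` in that class, is isomorphic to the Schützenberger group. -/
theorem nonempty_mulEquiv_schutzenbergerGroup {G : Type*} [Group G] {f : M} (θ : G → M)
    (hmem : ∀ σ, f * θ σ ∈ hClass f) (hmul : ∀ σ τ, f * θ (σ * τ) = f * θ τ * θ σ)
    (hinj : ∀ σ τ, f * θ σ = f * θ τ → σ = τ)
    (hsurj : ∀ t, f * t ∈ hClass f → ∃ σ, f * t = f * θ σ) :
    Nonempty (schutzenbergerGroup f ≃* G) := by
  -- Every element of the class is a left multiple of `f`, so a right translation is determined by
  -- its value at `f`; `θ` itself need not be multiplicative.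
  have hL : ∀ {x}, x ∈ hClass f → ∃ b, b * f = x := fun hx => (relL_iff.1 hx.1).2
  have hstab : ∀ σ, θ σ ∈ stab f := by
    intro σ x hx
    obtain ⟨b, hb⟩ := hL hx
    refine ⟨?_, ?_⟩
    · exact (hmem σ).1.trans (hx.1.mul_right (θ σ))
    · have h := (hmem σ).2.mul_left b
      rw [hb, ← mul_assoc, hb] at h
      exact hx.2.trans h
  let Φ : G →* schutzenbergerGroup f := MonoidHom.mk'
    (fun σ => ⟨gamma f ⟨θ σ, hstab σ⟩, ⟨_, rfl⟩⟩) (by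
      intro σ τ
      refine Subtype.ext (Equiv.ext fun x => Subtype.ext ?_)
      obtain ⟨b, hb⟩ := hL x.2
      change x.1 * θ (σ * τ) = x.1 * θ τ * θ σ
      rw [← hb, mul_assoc, hmul]
      simp only [mul_assoc])
  refine ⟨(MulEquiv.ofBijective Φ ⟨fun σ τ h => hinj σ τ ?_, ?_⟩).symm⟩
  · have := congrArg (fun p : schutzenbergerGroup f => (p.1 ⟨f, mem_hClass_self f⟩).1) h
    exact this
  · rintro ⟨_, t, rfl⟩
    obtain ⟨σ, hσ⟩ := hsurj t.1 (t.2 f (mem_hClass_self f))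
    refine ⟨σ, Subtype.ext (Equiv.ext fun x => Subtype.ext ?_)⟩
    obtain ⟨b, hb⟩ := hL x.2
    change x.1 * θ σ = x.1 * t.1
    rw [← hb, mul_assoc, mul_assoc, hσ]

end Green

/-! ### The extension property of the universal directed graph. -/

namespace Digraph

/-- The extension property of the countable universal directed graph, for a binary relation. -/
def HasExtensions {α : Type*} (r : α → α → Prop) : Prop :=
  ∀ F A B : Finset α, ∃ v ∉ F, ∀ x ∈ F, (r x v ↔ x ∈ A) ∧ (r v x ↔ x ∈ B)

theorem IsCountableUniversal.countable {V : Type u} {D : Digraph V}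
    (hD : D.IsCountableUniversal) : Countable V := hD.1

theorem IsCountableUniversal.irrefl {V : Type u} {D : Digraph V}
    (hD : D.IsCountableUniversal) (x : V) : ¬ D.Adj x x := by
  obtain ⟨_, h⟩ := hD
  let := D.toStructure
  intro hx
  -- A loop at `x` would put the one-point looped structure into the age.
  let G : Digraph PUnit.{u + 1} := ⟨fun _ _ => True⟩
  let := G.toStructure
  have hmem : (⟨PUnit.{u + 1}, G.toStructure⟩ : CategoryTheory.Bundled _) ∈ FirstOrder.Language.graph.age V := by
    refine ⟨FirstOrder.Language.Structure.fg_iff_finite.2 (inferInstanceAs (Finite PUnit)),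
      ⟨⟨⟨fun _ => x, fun _ _ _ => Subsingleton.elim (α := PUnit) _ _⟩, ?_, ?_⟩⟩⟩
    · intro n g; exact isEmptyElim g
    · rintro n ⟨⟩ y
      exact iff_of_true hx trivial
  rw [h.age] at hmem
  exact hmem.2 PUnit.unit trivial

/-- The one-point extension of the induced digraph on `F` lies in the age; ultrahomogeneity extends
the inclusion of `F` to it, and the new point goes to the required vertex. -/
theorem IsCountableUniversal.hasExtensions {V : Type u} {D : Digraph V}
    (hD : D.IsCountableUniversal) : HasExtensions D.Adj := by
  classical
  have hirr := hD.irrefl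
  obtain ⟨_, h⟩ := hD
  intro F A B
  let := D.toStructure
  let GS : Digraph F := ⟨fun x y => D.Adj x y⟩
  let GT : Digraph (Option F) := ⟨fun x y => match x, y with
    | some x, some y => D.Adj x y
    | some x, none => x.1 ∈ A
    | none, some y => y.1 ∈ B
    | none, none => False⟩
  let := GS.toStructure
  let := GT.toStructure
  have hT : Nonempty (FirstOrder.Language.Embedding FirstOrder.Language.graph (Option F) V) := by
    have hmem : (⟨Option F, GT.toStructure⟩ : CategoryTheory.Bundled _) ∈ FirstOrder.Language.graph.age V := by
      rw [h.age]
      refine ⟨inferInstanceAs (Finite (Option F)), ?_⟩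
      rintro (_ | x)
      · exact id
      · exact hirr x
    exact hmem.2
  obtain ⟨f', hf'⟩ := h.ultrahomogeneous.extend_embedding
    (FirstOrder.Language.Structure.fg_iff_finite.2 (inferInstanceAs (Finite F)))
    (S := F) (T := Option F)
    ⟨⟨Subtype.val, Subtype.val_injective⟩, fun n => isEmptyElim n, by rintro n ⟨⟩ y; exact Iff.rfl⟩
    ⟨⟨some, Option.some_injective _⟩, fun n => isEmptyElim n, by rintro n ⟨⟩ y; exact Iff.rfl⟩
  have hval : ∀ x : F, f' (some x) = x.1 := fun x => (DFunLike.congr_fun hf' x).symm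
  have hadj : ∀ x y : Option F, D.Adj (f' x) (f' y) ↔ GT.Adj x y := fun x y =>
    f'.map_rel FirstOrder.Language.adj ![x, y]
  refine ⟨f' none, fun hF => ?_, fun x hx => ⟨?_, ?_⟩⟩
  · have := f'.injective (hval ⟨_, hF⟩)
    simp at this
  · have := hadj (some ⟨x, hx⟩) none
    rwa [hval] at this
  · have := hadj none (some ⟨x, hx⟩)
    rwa [hval] at this

/-- A finite partial isomorphism between two binary relations, as a set of pairs. -/
def IsPartialIso {α β : Type*} (r : α → α → Prop) (s : β → β → Prop) (P : Finset (α × β)) : Prop :=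
  ∀ p ∈ P, ∀ q ∈ P, (p.1 = q.1 ↔ p.2 = q.2) ∧ (r p.1 q.1 ↔ s p.2 q.2)

/-! ### Back and forth. -/

section BackAndForth

variable {α : Type u} {β : Type v} {r : α → α → Prop} {s : β → β → Prop}

theorem IsPartialIso.exists_forth (hr : ∀ a, ¬ r a a) (hs : ∀ b, ¬ s b b) (h : HasExtensions s)
    {P : Finset (α × β)} (hP : IsPartialIso r s P) (a : α) :
    ∃ Q, P ⊆ Q ∧ IsPartialIso r s Q ∧ ∃ b, (a, b) ∈ Q := by
  classical
  by_cases ha : ∃ b, (a, b) ∈ P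
  · exact ⟨P, Finset.Subset.refl _, hP, ha⟩
  · obtain ⟨b, hb, hb'⟩ := h (P.image Prod.snd) ((P.filter fun p => r p.1 a).image Prod.snd)
      ((P.filter fun p => r a p.1).image Prod.snd)
    have key : ∀ p ∈ P, (¬ p.1 = a) ∧ (¬ p.2 = b) ∧ (s p.2 b ↔ r p.1 a) ∧ (s b p.2 ↔ r a p.1) := by
      intro p hp
      have hp2 : ∀ q ∈ P, q.2 = p.2 → q.1 = p.1 := fun q hq e => (hP q hq p hp).1.2 e
      obtain ⟨h1, h2⟩ := hb' p.2 (Finset.mem_image_of_mem _ hp)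
      refine ⟨fun e => ha ⟨p.2, e ▸ hp⟩, fun e => hb (e ▸ Finset.mem_image_of_mem _ hp), ?_, ?_⟩
      · rw [h1, Finset.mem_image]
        constructor
        · rintro ⟨q, hq, e⟩
          rw [Finset.mem_filter] at hq
          exact hp2 q hq.1 e ▸ hq.2
        · exact fun hh => ⟨p, Finset.mem_filter.2 ⟨hp, hh⟩, rfl⟩
      · rw [h2, Finset.mem_image]
        constructor
        · rintro ⟨q, hq, e⟩
          rw [Finset.mem_filter] at hq
          exact hp2 q hq.1 e ▸ hq.2
        · exact fun hh => ⟨p, Finset.mem_filter.2 ⟨hp, hh⟩, rfl⟩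
    refine ⟨insert (a, b) P, Finset.subset_insert _ _, ?_, b, Finset.mem_insert_self _ _⟩
    intro p hp q hq
    rw [Finset.mem_insert] at hp hq
    rcases hp with rfl | hp <;> rcases hq with rfl | hq
    · exact ⟨by simp, iff_of_false (hr _) (hs _)⟩
    · obtain ⟨h1, h2, h3, h4⟩ := key q hq
      exact ⟨iff_of_false (Ne.symm h1) (Ne.symm h2), h4.symm⟩
    · obtain ⟨h1, h2, h3, h4⟩ := key p hp
      exact ⟨iff_of_false h1 h2, h3.symm⟩
    · exact hP p hp q hq

theorem IsPartialIso.swap {P : Finset (α × β)} (hP : IsPartialIso r s P) :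
    IsPartialIso s r (P.map (Equiv.prodComm α β).toEmbedding) := by
  intro p hp q hq
  obtain ⟨p, hp', rfl⟩ := Finset.mem_map.1 hp
  obtain ⟨q, hq', rfl⟩ := Finset.mem_map.1 hq
  exact ⟨(hP p hp' q hq').1.symm, (hP p hp' q hq').2.symm⟩

theorem IsPartialIso.exists_back (hr : ∀ a, ¬ r a a) (hs : ∀ b, ¬ s b b) (h : HasExtensions r)
    {P : Finset (α × β)} (hP : IsPartialIso r s P) (b : β) :
    ∃ Q, P ⊆ Q ∧ IsPartialIso r s Q ∧ ∃ a, (a, b) ∈ Q := by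
  obtain ⟨Q, hPQ, hQ, a, ha⟩ := hP.swap.exists_forth hs hr h b
  refine ⟨Q.map (Equiv.prodComm β α).toEmbedding, fun p hp => ?_, hQ.swap, a,
    Finset.mem_map.2 ⟨_, ha, rfl⟩⟩
  exact Finset.mem_map.2 ⟨p.swap, hPQ (Finset.mem_map.2 ⟨p, hp, rfl⟩), rfl⟩

/-- Two countable irreflexive relations with the extension property are isomorphic. -/
theorem HasExtensions.nonempty_relIso [Countable α] [Countable β] (hr : ∀ a, ¬ r a a)
    (hs : ∀ b, ¬ s b b) (hr' : HasExtensions r) (hs' : HasExtensions s) : Nonempty (r ≃r s) := by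
  classical
  have step : ∀ (P : {P : Finset (α × β) // IsPartialIso r s P}) (c : α ⊕ β),
      ∃ Q : {P : Finset (α × β) // IsPartialIso r s P}, P.1 ⊆ Q.1 ∧
        (∀ a, c = .inl a → ∃ b, (a, b) ∈ Q.1) ∧ (∀ b, c = .inr b → ∃ a, (a, b) ∈ Q.1) := by
    rintro P (a | b)
    · obtain ⟨Q, hPQ, hQ, h⟩ := P.2.exists_forth hr hs hs' a
      exact ⟨⟨Q, hQ⟩, hPQ, by rintro _ ⟨⟩; exact h, by simp⟩
    · obtain ⟨Q, hPQ, hQ, h⟩ := P.2.exists_back hr hs hr' b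
      exact ⟨⟨Q, hQ⟩, hPQ, by simp, by rintro _ ⟨⟩; exact h⟩
  choose next hsub hleft hright using step
  obtain ⟨v, -⟩ := hr' ∅ ∅ ∅
  have : Nonempty (α ⊕ β) := ⟨.inl v⟩
  obtain ⟨enum, henum⟩ := exists_surjective_nat (α ⊕ β)
  let P : ℕ → {P : Finset (α × β) // IsPartialIso r s P} :=
    fun n => Nat.rec ⟨∅, by intro p hp; simp at hp⟩ (fun n Q => next Q (enum n)) n
  have hmono : Monotone fun n => (P n).1 := monotone_nat_of_le_succ fun n => hsub (P n) (enum n)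
  have hl : ∀ a, ∃ b n, (a, b) ∈ (P n).1 := by
    intro a
    obtain ⟨n, hn⟩ := henum (.inl a)
    obtain ⟨b, hb⟩ := hleft (P n) (enum n) a hn
    exact ⟨b, n + 1, hb⟩
  have hr : ∀ b, ∃ a n, (a, b) ∈ (P n).1 := by
    intro b
    obtain ⟨n, hn⟩ := henum (.inr b)
    obtain ⟨a, ha⟩ := hright (P n) (enum n) b hn
    exact ⟨a, n + 1, ha⟩
  have hcomp : ∀ {p q : α × β} {m n}, p ∈ (P m).1 → q ∈ (P n).1 →
      (p.1 = q.1 ↔ p.2 = q.2) ∧ (r p.1 q.1 ↔ s p.2 q.2) := by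
    intro p q m n hp hq
    exact (P (max m n)).2 p (hmono (le_max_left m n) hp) q (hmono (le_max_right m n) hq)
  choose f n hf using hl
  choose g m hg using hr
  exact ⟨⟨⟨f, g, fun a => (hcomp (hg (f a)) (hf a)).1.2 rfl,
    fun b => (hcomp (hf (g b)) (hg b)).1.1 rfl⟩, fun {a b} => (hcomp (hf a) (hf b)).2.symm⟩⟩

end BackAndForth

end Digraph

/-! ### The free construction and its automorphisms. -/

namespace Digraph

/-- The stages of the free construction: the vertices of the next stage are those of the present
one, and a new vertex for each pair of finite sets of present vertices. -/
def Stage (B : Type v) : ℕ → Type v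
  | 0 => B
  | n + 1 => Stage B n ⊕ (Finset (Stage B n) × Finset (Stage B n))

/-- The vertices of the free construction over `B`. A vertex of the second kind is given by its
stage, its set of earlier in-neighbours and its set of earlier out-neighbours. -/
def Free (B : Type v) : Type v := B ⊕ Σ n, Finset (Stage B n) × Finset (Stage B n)

namespace Free

variable {B : Type v}

/-- A vertex of the base. -/
def base (b : B) : Free B := Sum.inl b

/-- The embedding of a stage. -/
def ofStage : ∀ n, Stage B n → Free B
  | 0, b => base b
  | n + 1, x => Sum.elim (ofStage n) (fun s => Sum.inr ⟨n, s⟩) x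

/-- The stage at which a vertex appears. -/
def lev : Free B → ℕ := Sum.elim (fun _ => 0) (fun s => s.1 + 1)

@[simp] theorem lev_base (b : B) : lev (base b) = 0 := rfl

theorem base_injective : Function.Injective (base : B → Free B) := Sum.inl_injective

theorem exists_base_of_lev_eq_zero {v : Free B} (h : lev v = 0) : ∃ b, base b = v := by
  rcases v with b | s
  · exact ⟨b, rfl⟩
  · exact absurd h (Nat.succ_ne_zero _)

theorem lev_ofStage_le (n : ℕ) (x : Stage B n) : lev (ofStage n x) ≤ n := by
  induction n with
  | zero => exact le_rfl
  | succ n ih =>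
    rcases x with x | s
    · exact (ih x).trans (Nat.le_succ n)
    · exact le_rfl

theorem ofStage_injective (n : ℕ) : Function.Injective (ofStage (B := B) n) := by
  induction n with
  | zero => exact base_injective
  | succ n ih =>
    rintro (x | s) (y | t) h
    · exact congrArg Sum.inl (ih h)
    · have h1 := lev_ofStage_le n x
      have h2 : lev (ofStage n x) = n + 1 := congrArg lev h
      omega
    · have h1 := lev_ofStage_le n y
      have h2 : n + 1 = lev (ofStage n y) := congrArg lev h
      omega
    · have h1 : (⟨n, s⟩ : Σ n, Finset (Stage B n) × Finset (Stage B n)) = ⟨n, t⟩ :=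
        Sum.inr_injective h
      exact congrArg Sum.inr (eq_of_heq (Sigma.mk.inj h1).2)

theorem exists_ofStage {n : ℕ} {v : Free B} (h : lev v ≤ n) : ∃ x, ofStage n x = v := by
  induction n with
  | zero => exact exists_base_of_lev_eq_zero (Nat.le_zero.1 h)
  | succ n ih =>
    rcases h.lt_or_eq with h | h
    · obtain ⟨x, hx⟩ := ih (Nat.lt_succ_iff.1 h)
      exact ⟨Sum.inl x, hx⟩
    · rcases v with b | ⟨m, s⟩
      · exact absurd h (Nat.succ_ne_zero n).symm
      · obtain rfl : m = n := Nat.succ_injective h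
        exact ⟨Sum.inr s, rfl⟩

/-- The in-neighbours of a vertex at earlier stages. -/
def inn : Free B → Finset (Free B) :=
  Sum.elim (fun _ => ∅) (fun s => s.2.1.map ⟨ofStage s.1, ofStage_injective s.1⟩)

/-- The out-neighbours of a vertex at earlier stages. -/
def out : Free B → Finset (Free B) :=
  Sum.elim (fun _ => ∅) (fun s => s.2.2.map ⟨ofStage s.1, ofStage_injective s.1⟩)

theorem lev_lt_of_mem_inn {u v : Free B} (h : u ∈ inn v) : lev u < lev v := by
  rcases v with b | ⟨n, s⟩
  · exact absurd h (Finset.notMem_empty _)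
  · obtain ⟨x, -, rfl⟩ := Finset.mem_map.1 h
    exact Nat.lt_succ_of_le (lev_ofStage_le n x)

theorem lev_lt_of_mem_out {u v : Free B} (h : u ∈ out v) : lev u < lev v := by
  rcases v with b | ⟨n, s⟩
  · exact absurd h (Finset.notMem_empty _)
  · obtain ⟨x, -, rfl⟩ := Finset.mem_map.1 h
    exact Nat.lt_succ_of_le (lev_ofStage_le n x)

theorem eq_of_inn_of_out {u v : Free B} {n : ℕ} (hu : lev u = n + 1) (hv : lev v = n + 1)
    (hi : inn u = inn v) (ho : out u = out v) : u = v := by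
  rcases u with b | ⟨m, s⟩
  · exact absurd hu (Nat.succ_ne_zero n).symm
  rcases v with b | ⟨k, t⟩
  · exact absurd hv (Nat.succ_ne_zero n).symm
  obtain rfl : m = n := Nat.succ_injective hu
  obtain rfl : k = m := Nat.succ_injective hv
  have h1 := Finset.map_injective _ hi
  have h2 := Finset.map_injective _ ho
  exact congrArg Sum.inr (congrArg (Sigma.mk k) (Prod.ext h1 h2))

theorem exists_preimage_finset {n : ℕ} (A : Finset (Free B)) (hA : ∀ x ∈ A, lev x ≤ n) :
    ∃ A' : Finset (Stage B n), A'.map ⟨ofStage n, ofStage_injective n⟩ = A := by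
  classical
  refine ⟨A.preimage (ofStage n) (ofStage_injective n).injOn, ?_⟩
  ext x
  simp only [Finset.mem_map, Finset.mem_preimage, Function.Embedding.coeFn_mk]
  constructor
  · rintro ⟨y, hy, rfl⟩
    exact hy
  · intro hx
    obtain ⟨y, rfl⟩ := exists_ofStage (hA x hx)
    exact ⟨y, hx, rfl⟩

theorem exists_inn_out {n : ℕ} (A C : Finset (Free B)) (hA : ∀ x ∈ A, lev x ≤ n)
    (hC : ∀ x ∈ C, lev x ≤ n) : ∃ v, lev v = n + 1 ∧ inn v = A ∧ out v = C := by
  obtain ⟨A', hA'⟩ := exists_preimage_finset A hA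
  obtain ⟨C', hC'⟩ := exists_preimage_finset C hC
  exact ⟨Sum.inr ⟨n, A', C'⟩, rfl, hA', hC'⟩

instance [Countable B] (n : ℕ) : Countable (Stage B n) := by
  induction n with
  | zero => exact inferInstanceAs (Countable B)
  | succ n ih => exact inferInstanceAs
      (Countable (Stage B n ⊕ (Finset (Stage B n) × Finset (Stage B n))))

instance [Countable B] : Countable (Free B) :=
  inferInstanceAs (Countable (B ⊕ Σ n, Finset (Stage B n) × Finset (Stage B n)))

/-- The edges of the free construction over a relation `r`. -/
def Rel (r : B → B → Prop) (u v : Free B) : Prop :=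
  (∃ a b, u = base a ∧ v = base b ∧ r a b) ∨ u ∈ inn v ∨ v ∈ out u

variable {r : B → B → Prop}

@[simp] theorem rel_base {a b : B} : Rel r (base a) (base b) ↔ r a b := by
  constructor
  · rintro (⟨a', b', ha, hb, h⟩ | h | h)
    · rwa [base_injective ha, base_injective hb]
    · exact absurd (lev_lt_of_mem_inn h) (lt_irrefl 0)
    · exact absurd (lev_lt_of_mem_out h) (lt_irrefl 0)
  · exact fun h => Or.inl ⟨a, b, rfl, rfl, h⟩

theorem rel_iff_mem_inn {u v : Free B} (h : lev u < lev v) : Rel r u v ↔ u ∈ inn v := by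
  constructor
  · rintro (⟨a, b, rfl, rfl, -⟩ | h' | h')
    · exact absurd h (lt_irrefl 0)
    · exact h'
    · exact absurd (lev_lt_of_mem_out h') h.not_gt
  · exact fun h => Or.inr (Or.inl h)

theorem rel_iff_mem_out {u v : Free B} (h : lev v < lev u) : Rel r u v ↔ v ∈ out u := by
  constructor
  · rintro (⟨a, b, rfl, rfl, -⟩ | h' | h')
    · exact absurd h (lt_irrefl 0)
    · exact absurd (lev_lt_of_mem_inn h') h.not_gt
    · exact h'
  · exact fun h => Or.inr (Or.inr h)

theorem not_rel_of_lev_eq {u v : Free B} {n : ℕ} (hu : lev u = n + 1) (hv : lev v = n + 1) :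
    ¬ Rel r u v := by
  rintro (⟨a, b, rfl, rfl, -⟩ | h | h)
  · exact absurd hu (Nat.succ_ne_zero n).symm
  · exact absurd (lev_lt_of_mem_inn h) (by omega)
  · exact absurd (lev_lt_of_mem_out h) (by omega)

theorem rel_irrefl (hr : ∀ b, ¬ r b b) (u : Free B) : ¬ Rel r u u := by
  rintro (⟨a, b, rfl, h, hab⟩ | h | h)
  · rw [base_injective h] at hab
    exact hr _ hab
  · exact absurd (lev_lt_of_mem_inn h) (lt_irrefl _)
  · exact absurd (lev_lt_of_mem_out h) (lt_irrefl _)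

theorem rel_hasExtensions (r : B → B → Prop) : HasExtensions (Rel r) := by
  classical
  intro F A C
  have hF : ∀ x ∈ F, lev x ≤ F.sup lev := fun x hx => Finset.le_sup hx
  -- The vertex is taken one level above all of `F`. The intersections are needed because `A` and
  -- `C` may contain vertices of higher level.
  obtain ⟨v, hv, hi, ho⟩ := exists_inn_out (F ∩ A) (F ∩ C)
    (fun x hx => hF x (Finset.mem_of_mem_inter_left hx))
    (fun x hx => hF x (Finset.mem_of_mem_inter_left hx))
  have hlt : ∀ x ∈ F, lev x < lev v := fun x hx => by rw [hv]; exact Nat.lt_succ_of_le (hF x hx)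
  refine ⟨v, fun h => lt_irrefl _ (hlt v h), fun x hx => ?_⟩
  rw [rel_iff_mem_inn (hlt x hx), rel_iff_mem_out (hlt x hx), hi, ho]
  simp [hx]

/-- The action on the stages of a permutation of the base. -/
def stageMap (e : B ≃ B) : ∀ n, Stage B n ≃ Stage B n
  | 0 => e
  | n + 1 => Equiv.sumCongr (stageMap e n)
      (Equiv.prodCongr (stageMap e n).finsetCongr (stageMap e n).finsetCongr)

/-- The action on the vertices of a permutation of the base. -/
def map (e : B ≃ B) : Free B ≃ Free B :=
  Equiv.sumCongr e (Equiv.sigmaCongrRight fun n =>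
    Equiv.prodCongr (stageMap e n).finsetCongr (stageMap e n).finsetCongr)

@[simp] theorem map_base (e : B ≃ B) (b : B) : map e (base b) = base (e b) := rfl

@[simp] theorem lev_map (e : B ≃ B) (v : Free B) : lev (map e v) = lev v := by
  rcases v with b | s <;> rfl

theorem map_ofStage (e : B ≃ B) (n : ℕ) (x : Stage B n) :
    map e (ofStage n x) = ofStage n (stageMap e n x) := by
  induction n with
  | zero => rfl
  | succ n ih =>
    rcases x with x | s
    · exact ih x
    · rfl

theorem map_finset (e : B ≃ B) (n : ℕ) (A : Finset (Stage B n)) :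
    ((stageMap e n).finsetCongr A).map ⟨ofStage n, ofStage_injective n⟩ =
      (A.map ⟨ofStage n, ofStage_injective n⟩).map (map e).toEmbedding := by
  rw [Equiv.finsetCongr_apply, Finset.map_map, Finset.map_map]
  congr 1
  ext x
  exact (map_ofStage e n x).symm

theorem inn_map (e : B ≃ B) (v : Free B) : inn (map e v) = (inn v).map (map e).toEmbedding := by
  rcases v with b | s
  · rfl
  · exact map_finset e s.1 s.2.1

theorem out_map (e : B ≃ B) (v : Free B) : out (map e v) = (out v).map (map e).toEmbedding := by
  rcases v with b | s
  · rfl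
  · exact map_finset e s.1 s.2.2

theorem rel_map {e : B ≃ B} (he : ∀ a b, r (e a) (e b) ↔ r a b) (u v : Free B) :
    Rel r (map e u) (map e v) ↔ Rel r u v := by
  have h0 : ∀ w b, map e w = base b → ∃ c, w = base c ∧ b = e c := by
    intro w b hw
    have h : lev (map e w) = 0 := congrArg lev hw
    rw [lev_map] at h
    obtain ⟨c, rfl⟩ := exists_base_of_lev_eq_zero h
    exact ⟨c, rfl, (base_injective hw).symm⟩
  refine or_congr ?_ (or_congr ?_ ?_)
  · constructor
    · rintro ⟨a, b, ha, hb, hab⟩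
      obtain ⟨c, rfl, rfl⟩ := h0 _ _ ha
      obtain ⟨d, rfl, rfl⟩ := h0 _ _ hb
      exact ⟨c, d, rfl, rfl, (he c d).1 hab⟩
    · rintro ⟨a, b, rfl, rfl, hab⟩
      exact ⟨_, _, rfl, rfl, (he a b).2 hab⟩
  · rw [inn_map]
    exact Finset.mem_map' _
  · rw [out_map]
    exact Finset.mem_map' _

/-- Two maps that preserve the stages and the edges and agree on the base are equal. -/
theorem eqOn_of_base {φ ψ : Free B ≃ Free B} (hφ : ∀ v, lev (φ v) = lev v)
    (hψ : ∀ v, lev (ψ v) = lev v) (rφ : ∀ u v, Rel r (φ u) (φ v) ↔ Rel r u v)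
    (rψ : ∀ u v, Rel r (ψ u) (ψ v) ↔ Rel r u v) (h : ∀ b, φ (base b) = ψ (base b))
    (v : Free B) : φ v = ψ v := by
  -- Between different levels the edges are exactly `inn` and `out`, so a map preserving levels and
  -- edges transports both.
  have hin : ∀ (χ : Free B ≃ Free B), (∀ v, lev (χ v) = lev v) →
      (∀ u v, Rel r (χ u) (χ v) ↔ Rel r u v) → ∀ v, inn (χ v) = (inn v).map χ.toEmbedding ∧
        out (χ v) = (out v).map χ.toEmbedding := by
    intro χ hχ rχ v
    constructor <;> ext x <;> obtain ⟨y, rfl⟩ := χ.surjective x <;>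
      rw [show χ y = χ.toEmbedding y from rfl, Finset.mem_map'] <;> constructor <;> intro hx
    · have := lev_lt_of_mem_inn hx
      rw [← rel_iff_mem_inn (r := r) (by simpa [hχ] using this)]
      rw [← rel_iff_mem_inn (r := r) this] at hx
      exact (rχ _ _).1 hx
    · have := lev_lt_of_mem_inn hx
      rw [← rel_iff_mem_inn (r := r) (by simpa [hχ] using this)]
      rw [← rel_iff_mem_inn (r := r) this] at hx
      exact (rχ _ _).2 hx
    · have := lev_lt_of_mem_out hx
      rw [← rel_iff_mem_out (r := r) (by simpa [hχ] using this)]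
      rw [← rel_iff_mem_out (r := r) this] at hx
      exact (rχ _ _).1 hx
    · have := lev_lt_of_mem_out hx
      rw [← rel_iff_mem_out (r := r) (by simpa [hχ] using this)]
      rw [← rel_iff_mem_out (r := r) this] at hx
      exact (rχ _ _).2 hx
  induction hn : lev v using Nat.strong_induction_on generalizing v with
  | _ n ih =>
    rcases n with _ | n
    · obtain ⟨b, rfl⟩ := exists_base_of_lev_eq_zero hn
      exact h b
    · have hmap : ∀ A : Finset (Free B), (∀ x ∈ A, lev x < lev v) →
          A.map φ.toEmbedding = A.map ψ.toEmbedding := by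
        classical
        intro A hA
        simp only [Finset.map_eq_image]
        exact Finset.image_congr fun x hx => ih (lev x) (hn ▸ hA x hx) x rfl
      refine eq_of_inn_of_out ((hφ v).trans hn) ((hψ v).trans hn) ?_ ?_
      · rw [(hin φ hφ rφ v).1, (hin ψ hψ rψ v).1, hmap _ fun x hx => lev_lt_of_mem_inn hx]
      · rw [(hin φ hφ rφ v).2, (hin ψ hψ rψ v).2, hmap _ fun x hx => lev_lt_of_mem_out hx]

/-! ### Recovering the levels and `S` from the two relations. -/

theorem infinite_lev_eq [Infinite B] (n : ℕ) : {v : Free B | lev v = n}.Infinite := by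
  rcases n with _ | n
  · exact Set.infinite_of_injective_forall_mem base_injective fun b => lev_base b
  · have h : ∀ b : B, ∃ v : Free B, lev v = n + 1 ∧ inn v = {base b} ∧ out v = ∅ := by
      intro b
      exact exists_inn_out _ _ (by simp) (by simp)
    choose f hf using h
    refine Set.infinite_of_injective_forall_mem (f := f) (fun a b hab => ?_) fun b => (hf b).1
    have := (hf a).2.1
    rw [hab, (hf b).2.1] at this
    exact (base_injective (Finset.singleton_injective this)).symm

theorem exists_lev_eq_not_rel [Infinite B] (r : B → B → Prop) {u : Free B} {n : ℕ}
    (h : n < lev u) : ∃ v, lev v = n ∧ ¬ Rel r u v := by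
  obtain ⟨v, hv, hu⟩ := (infinite_lev_eq (B := B) n).exists_notMem_finset (out u)
  refine ⟨v, hv, fun hr => hu ?_⟩
  rwa [rel_iff_mem_out (by rwa [show lev v = n from hv])] at hr

/-- The edges of the free construction, with all pairs that go down in the stages, and all pairs
of distinct vertices within each of the stages `n + 1`, `n ∈ S`. -/
def Rel' (r : B → B → Prop) (S : Set ℕ) (u v : Free B) : Prop :=
  Rel r u v ∨ lev v < lev u ∨ (u ≠ v ∧ ∃ n ∈ S, lev u = n + 1 ∧ lev v = n + 1)

theorem rel'_irrefl (hr : ∀ b, ¬ r b b) (S : Set ℕ) (u : Free B) : ¬ Rel' r S u u := by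
  rintro (h | h | ⟨h, -⟩)
  · exact rel_irrefl hr u h
  · exact lt_irrefl _ h
  · exact h rfl

theorem rel'_map {e : B ≃ B} (he : ∀ a b, r (e a) (e b) ↔ r a b) (S : Set ℕ) (u v : Free B) :
    Rel' r S (map e u) (map e v) ↔ Rel' r S u v := by
  simp only [Rel', rel_map he, lev_map, ne_eq, EmbeddingLike.apply_eq_iff_eq]

/-- Pairs added within a level come in both directions, those that drop in level in only one. The
right side mentions only the two relations, so isomorphisms preserve it. -/
theorem lev_lt_and_not_rel_iff (S : Set ℕ) (u v : Free B) :
    (lev v < lev u ∧ ¬ Rel r u v) ↔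
      (Rel' r S u v ∧ ¬ Rel r u v) ∧ ¬ (Rel' r S v u ∧ ¬ Rel r v u) := by
  constructor
  · rintro ⟨h, h'⟩
    refine ⟨⟨Or.inr (Or.inl h), h'⟩, ?_⟩
    rintro ⟨h1 | h1 | ⟨h1, n, -, h2, h3⟩, h4⟩
    · exact h4 h1
    · exact h.not_gt h1
    · omega
  · rintro ⟨⟨h1 | h1 | ⟨h1, n, hn, h2, h3⟩, h'⟩, h4⟩
    · exact absurd h1 h'
    · exact ⟨h1, h'⟩
    · exact absurd ⟨Or.inr (Or.inr ⟨h1.symm, n, hn, h3, h2⟩), not_rel_of_lev_eq h3 h2⟩ h4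

theorem lev_le_of_iso [Infinite B] {S T : Set ℕ} {φ : Free B ≃ Free B}
    (h : ∀ u v, Rel r (φ u) (φ v) ↔ Rel r u v)
    (h' : ∀ u v, Rel' r T (φ u) (φ v) ↔ Rel' r S u v) (v : Free B) : lev v ≤ lev (φ v) := by
  induction hn : lev v using Nat.strong_induction_on generalizing v with
  | _ n ih =>
    rcases n with _ | n
    · exact Nat.zero_le _
    -- Level `n` is infinite while `out v` is finite, so some pair `(v, x)` drops by exactly one
    -- level and is not an edge; its image also drops.
    · obtain ⟨x, hx, hvx⟩ := exists_lev_eq_not_rel r (show n < lev v by omega)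
      have h1 := (lev_lt_and_not_rel_iff S v x).1 ⟨by omega, hvx⟩
      rw [← h', ← h', ← h v x, ← h x v, ← lev_lt_and_not_rel_iff T] at h1
      have h2 := ih n (Nat.lt_succ_self n) x hx
      omega

theorem lev_eq_of_iso [Infinite B] {S T : Set ℕ} {φ : Free B ≃ Free B}
    (h : ∀ u v, Rel r (φ u) (φ v) ↔ Rel r u v)
    (h' : ∀ u v, Rel' r T (φ u) (φ v) ↔ Rel' r S u v) (v : Free B) : lev (φ v) = lev v := by
  refine le_antisymm ?_ (lev_le_of_iso h h' v)
  have := lev_le_of_iso (r := r) (S := T) (T := S) (φ := φ.symm)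
    (fun u v => by rw [← h]; simp) (fun u v => by rw [← h']; simp) (φ v)
  simpa using this

theorem eq_of_iso [Infinite B] {S T : Set ℕ} {φ : Free B ≃ Free B}
    (h : ∀ u v, Rel r (φ u) (φ v) ↔ Rel r u v)
    (h' : ∀ u v, Rel' r T (φ u) (φ v) ↔ Rel' r S u v) : S = T := by
  have key : ∀ (R : Set ℕ) (n : ℕ) (u v : Free B), u ≠ v → lev u = n + 1 → lev v = n + 1 →
      (Rel' r R u v ↔ n ∈ R) := by
    intro R n u v huv hu hv
    constructor
    · rintro (h1 | h1 | ⟨-, m, hm, h1, h2⟩)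
      · exact absurd h1 (not_rel_of_lev_eq hu hv)
      · omega
      · obtain rfl : m = n := by omega
        exact hm
    · exact fun hn => Or.inr (Or.inr ⟨huv, n, hn, hu, hv⟩)
  ext n
  obtain ⟨u, hu, v, hv, huv⟩ := (infinite_lev_eq (B := B) (n + 1)).nontrivial
  rw [← key S n u v huv hu hv, ← h', key T n _ _ (φ.injective.ne huv)
    ((lev_eq_of_iso h h' u).trans hu) ((lev_eq_of_iso h h' v).trans hv)]

theorem exists_rel'_not_rel [Infinite B] (r : B → B → Prop) (S : Set ℕ) :
    ∃ u v, Rel' r S u v ∧ ¬ Rel r u v := by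
  obtain ⟨u, hu⟩ := (infinite_lev_eq (B := B) 1).nonempty
  have hu : lev u = 1 := hu
  obtain ⟨v, hv, h⟩ := exists_lev_eq_not_rel r (show 0 < lev u by omega)
  exact ⟨u, v, Or.inr (Or.inl (by omega)), h⟩

end Free

/-- A relation whose automorphisms are those of `Γ`: the vertices of `Γ` and a linear order of
type `ω` below them. -/
def rayRel {W : Type v} (Γ : SimpleGraph W) : ℕ ⊕ W → ℕ ⊕ W → Prop
  | .inl i, .inl j => i < j
  | .inl _, .inr _ => True
  | .inr _, .inl _ => False
  | .inr a, .inr b => Γ.Adj a b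

/-! ### Automorphisms of the base. -/

section Ray

variable {W : Type v} (Γ : SimpleGraph W)

theorem rayRel_irrefl (x : ℕ ⊕ W) : ¬ rayRel Γ x x := by
  rcases x with i | w
  · exact lt_irrefl i
  · exact Γ.loopless.irrefl w

theorem rayRel_sumCongr (σ : Γ ≃g Γ) (x y : ℕ ⊕ W) :
    rayRel Γ (Equiv.sumCongr (Equiv.refl ℕ) σ.toEquiv x)
      (Equiv.sumCongr (Equiv.refl ℕ) σ.toEquiv y) ↔ rayRel Γ x y := by
  rcases x with i | w <;> rcases y with j | w'
  · exact Iff.rfl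
  · exact Iff.rfl
  · exact Iff.rfl
  · exact σ.map_rel_iff

theorem rayRel_aut_inl {e : (ℕ ⊕ W) ≃ (ℕ ⊕ W)} (he : ∀ x y, rayRel Γ (e x) (e y) ↔ rayRel Γ x y)
    (i : ℕ) : e (.inl i) = .inl i := by
  induction i using Nat.strong_induction_on with
  | _ i ih =>
    -- The numbers below `e (.inl i)` are less than `i`. A vertex of `Γ` has every number below it,
    -- which excludes it as the image.
    have hlt : ∀ k, rayRel Γ (.inl k) (e (.inl i)) → k < i := by
      intro k hk
      obtain ⟨x, hx⟩ := e.surjective (.inl k)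
      rw [← hx, he] at hk
      rcases x with j | w
      · have hj : j < i := hk
        rw [ih j hj] at hx
        exact Sum.inl_injective hx ▸ hj
      · exact hk.elim
    rcases hx : e (.inl i) with k | w
    · congr 1
      rw [hx] at hlt
      refine le_antisymm (not_lt.1 fun h => lt_irrefl i (hlt i h)) (not_lt.1 fun h => ?_)
      have := (he (.inl k) (.inl i)).2 h
      rw [ih k h, hx] at this
      exact lt_irrefl k this
    · rw [hx] at hlt
      exact absurd (hlt i trivial) (lt_irrefl i)

theorem rayRel_aut {e : (ℕ ⊕ W) ≃ (ℕ ⊕ W)} (he : ∀ x y, rayRel Γ (e x) (e y) ↔ rayRel Γ x y) :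
    ∃ σ : Γ ≃g Γ, ∀ x, e x = Equiv.sumCongr (Equiv.refl ℕ) σ.toEquiv x := by
  have hw : ∀ (e : (ℕ ⊕ W) ≃ (ℕ ⊕ W)), (∀ x y, rayRel Γ (e x) (e y) ↔ rayRel Γ x y) →
      ∀ w, ∃ w', e (.inr w) = .inr w' := by
    intro e he w
    rcases hx : e (.inr w) with i | w'
    · rw [← rayRel_aut_inl Γ he i] at hx
      exact absurd (e.injective hx) (by simp)
    · exact ⟨w', rfl⟩
  choose f hf using hw e he
  choose g hg using hw e.symm fun x y => by rw [← he]; simp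
  refine ⟨⟨⟨f, g, fun w => ?_, fun w => ?_⟩, fun {a b} => ?_⟩, ?_⟩
  · have := hg (f w)
    rw [← hf, e.symm_apply_apply] at this
    exact (Sum.inr_injective this).symm
  · have := hf (g w)
    rw [← hg, e.apply_symm_apply] at this
    exact (Sum.inr_injective this).symm
  · have := he (.inr a) (.inr b)
    rw [hf, hf] at this
    exact this
  · rintro (i | w)
    · exact rayRel_aut_inl Γ he i
    · exact hf w

end Ray

end Digraph

/-! ### Injective endomorphisms and Green's relations. -/

namespace Digraph

open Green Free

section EndMonoid

variable {V : Type u} {D : Digraph V}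

theorem EndMonoid.mul_apply (f g : D.EndMonoid) (x : V) :
    (f * g).unop x = g.unop (f.unop x) := rfl

theorem EndMonoid.ext {f g : D.EndMonoid} (h : ∀ x, f.unop x = g.unop x) : f = g :=
  MulOpposite.unop_injective (RelHom.ext h)

theorem EndMonoid.congr_apply {f g : D.EndMonoid} (h : f = g) (x : V) : f.unop x = g.unop x := by
  rw [h]

theorem EndMonoid.mk_card_le [Countable V] : #D.EndMonoid ≤ 𝔠 := by
  have h : Function.Injective (fun (f : D.EndMonoid) (x : V) => f.unop x) :=
    fun f g hfg => EndMonoid.ext fun x => congrFun hfg x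
  have h0 : #V ≤ ℵ₀ := Cardinal.mk_le_aleph0
  calc #D.EndMonoid ≤ #(V → V) := Cardinal.mk_le_of_injective h
    _ = #V ^ #V := by simp
    _ ≤ 𝔠 ^ ℵ₀ := (Cardinal.power_le_power_right (h0.trans Cardinal.aleph0_le_continuum)).trans
        (Cardinal.power_le_power_left Cardinal.continuum_ne_zero h0)
    _ = 𝔠 := Cardinal.continuum_power_aleph0

/-- Injective endomorphisms in one `D`-class have isomorphic images, where the image carries the
induced edges and the edges which are images of edges. -/
theorem exists_equiv_of_relD {f g : D.EndMonoid} (hf : Function.Injective f.unop)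
    (hg : Function.Injective g.unop) (h : RelD f g) :
    ∃ a : V ≃ V, (∀ x y, D.Adj (a x) (a y) ↔ D.Adj x y) ∧
      ∀ x y, D.Adj (g.unop (a x)) (g.unop (a y)) ↔ D.Adj (f.unop x) (f.unop y) := by
  obtain ⟨k, hL, hR⟩ := h
  obtain ⟨⟨a, ha⟩, b, hb⟩ := relL_iff.1 hL
  obtain ⟨⟨t, ht⟩, s, hs⟩ := relR_iff.1 hR
  -- The `L`-part gives the map `a` on the source; the `R`-part gives `s` and `t`, which carry `f x`
  -- to `g (a x)` and back.
  have e1 : ∀ x, s.unop (f.unop x) = g.unop (a.unop x) := by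
    intro x
    rw [← ha, ← hs]
    rfl
  have e2 : ∀ x, g.unop x = s.unop (f.unop (b.unop x)) := by
    intro x
    rw [← EndMonoid.mul_apply b f, hb, ← EndMonoid.mul_apply, hs]
  have e3 : ∀ x, f.unop x = t.unop (g.unop (a.unop x)) := by
    intro x
    rw [← EndMonoid.mul_apply g t, ht, ← EndMonoid.mul_apply, ha]
  have hab : ∀ x, a.unop (b.unop x) = x := fun x => hg (by rw [← e1, ← e2])
  have hba : ∀ x, b.unop (a.unop x) = x := by
    intro x
    apply hf
    rw [← EndMonoid.mul_apply b f, hb, ← EndMonoid.mul_apply, ha]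
  refine ⟨⟨a.unop, b.unop, hba, hab⟩, fun x y => ⟨fun h => ?_, fun h => a.unop.map_rel h⟩,
    fun x y => ⟨fun h => ?_, fun h => ?_⟩⟩
  · have := b.unop.map_rel h
    simpa only [Equiv.coe_fn_mk, hba] using this
  · rw [e3, e3]
    exact t.unop.map_rel h
  · have := s.unop.map_rel h
    rwa [e1, e1] at this

/-- The `L`-relation moves `t` to the source of `f`, where injectivity makes it bijective; the
`R`-relation inverts `t` on the image of `f`, so that edges are reflected. -/
theorem exists_equiv_of_mem_hClass {f t : D.EndMonoid} (hf : Function.Injective f.unop)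
    (h : f * t ∈ hClass f) :
    ∃ a : V ≃ V, (∀ x y, D.Adj (a x) (a y) ↔ D.Adj x y) ∧
      (∀ x y, D.Adj (f.unop (a x)) (f.unop (a y)) ↔ D.Adj (f.unop x) (f.unop y)) ∧
      ∀ x, t.unop (f.unop x) = f.unop (a x) := by
  obtain ⟨⟨b, hb⟩, a, ha⟩ := relL_iff.1 h.1
  obtain ⟨s, hs⟩ := (relR_iff.1 h.2).1
  have e1 : ∀ x, t.unop (f.unop x) = f.unop (a.unop x) := fun x =>
    (EndMonoid.congr_apply ha x).symm
  have e2 : ∀ x, t.unop (f.unop (b.unop x)) = f.unop x := EndMonoid.congr_apply hb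
  have e3 : ∀ x, s.unop (t.unop (f.unop x)) = f.unop x := EndMonoid.congr_apply hs
  have hab : ∀ x, a.unop (b.unop x) = x := fun x => hf (by rw [← e1, e2])
  have hba : ∀ x, b.unop (a.unop x) = x := fun x => hf (by rw [← e3 (b.unop _), e2, ← e1, e3])
  refine ⟨⟨a.unop, b.unop, hba, hab⟩, fun x y => ⟨fun h => ?_, fun h => a.unop.map_rel h⟩,
    fun x y => ⟨fun h => ?_, fun h => ?_⟩, e1⟩
  · have := b.unop.map_rel h
    simpa only [Equiv.coe_fn_mk, hba] using this
  · rw [← e3 x, ← e3 y, e1, e1]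
    exact s.unop.map_rel h
  · have := t.unop.map_rel h
    rwa [e1, e1] at this

end EndMonoid

/-- An endomorphism of `D` that maps it onto the first of two free constructions, the second of
which has the pairs in `Rel'` as edges of its base and is again isomorphic to `D`. -/
structure Coding {V : Type u} (D : Digraph V) {W : Type v} (Γ : SimpleGraph W) (S : Set ℕ) where
  /-- The coded endomorphism. -/
  f : D.EndMonoid
  /-- The isomorphism onto the first construction. -/
  e : D.Adj ≃r Rel (rayRel Γ)
  /-- The isomorphism from the second construction. -/
  e' : Rel (Rel' (rayRel Γ) S) ≃r D.Adj
  apply_eq : ∀ x, f.unop x = e' (base (e x))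

theorem IsCountableUniversal.nonempty_coding {V : Type u} {D : Digraph V}
    (hD : D.IsCountableUniversal) {W : Type v} [Countable W] (Γ : SimpleGraph W) (S : Set ℕ) :
    Nonempty (Coding D Γ S) := by
  have := hD.countable
  have hr := rayRel_irrefl Γ
  obtain ⟨e⟩ := HasExtensions.nonempty_relIso hD.irrefl (rel_irrefl hr) hD.hasExtensions
    (rel_hasExtensions (rayRel Γ))
  obtain ⟨e'⟩ := HasExtensions.nonempty_relIso (rel_irrefl (rel'_irrefl hr S)) hD.irrefl
    (rel_hasExtensions (Rel' (rayRel Γ) S)) hD.hasExtensions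
  exact ⟨⟨MulOpposite.op ⟨fun x => e' (base (e x)), fun h =>
    e'.map_rel_iff.2 (rel_base.2 (Or.inl (e.map_rel_iff.2 h)))⟩, e, e', fun _ => rfl⟩⟩

/-! ### Non-regularity, `D`-classes and Schützenberger groups of the coded endomorphisms. -/

namespace Coding

variable {V : Type u} {D : Digraph V} {W : Type v} {Γ : SimpleGraph W} {S T : Set ℕ}

theorem injective (c : Coding D Γ S) : Function.Injective c.f.unop := by
  intro x y h
  rw [c.apply_eq, c.apply_eq] at h
  exact c.e.injective (base_injective (c.e'.injective h))

theorem adj_iff (c : Coding D Γ S) (x y : V) :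
    D.Adj (c.f.unop x) (c.f.unop y) ↔ Rel' (rayRel Γ) S (c.e x) (c.e y) := by
  rw [c.apply_eq, c.apply_eq, c.e'.map_rel_iff, rel_base]

theorem not_regular (c : Coding D Γ S) : ¬ Regular c.f := by
  rintro ⟨g, hg⟩
  obtain ⟨u, v, h, h'⟩ := exists_rel'_not_rel (rayRel Γ) S
  obtain ⟨x, rfl⟩ := c.e.surjective u
  obtain ⟨y, rfl⟩ := c.e.surjective v
  -- Cancelling the injective `f` makes `g` undo it, so `g` would turn an added pair into an edge of
  -- `D`.
  have key : ∀ x, g.unop (c.f.unop x) = x := fun x =>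
    c.injective (EndMonoid.congr_apply hg x)
  rw [← c.adj_iff] at h
  have := g.unop.map_rel h
  rw [key, key] at this
  exact h' (c.e.map_rel_iff.2 this)

theorem conj_apply (c : Coding D Γ S) (d : Coding D Γ T) (a : V ≃ V) (x : V) :
    ((c.e.toEquiv.symm.trans a).trans d.e.toEquiv) (c.e x) = d.e (a x) :=
  congrArg (fun y => d.e (a y)) (c.e.symm_apply_apply x)

theorem eq_of_relD (c : Coding D Γ S) (d : Coding D Γ T) (h : RelD c.f d.f) : S = T := by
  obtain ⟨a, ha, ha'⟩ := exists_equiv_of_relD c.injective d.injective h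
  refine eq_of_iso (r := rayRel Γ) (φ := (c.e.toEquiv.symm.trans a).trans d.e.toEquiv)
    (fun u v => ?_) (fun u v => ?_)
  · obtain ⟨x, rfl⟩ := c.e.surjective u
    obtain ⟨y, rfl⟩ := c.e.surjective v
    rw [conj_apply, conj_apply, c.e.map_rel_iff, d.e.map_rel_iff, ha]
  · obtain ⟨x, rfl⟩ := c.e.surjective u
    obtain ⟨y, rfl⟩ := c.e.surjective v
    rw [conj_apply, conj_apply, ← c.adj_iff, ← d.adj_iff, ha']

/-- The permutation of the first construction given by an automorphism of `Γ`. -/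
def act (σ : Γ ≃g Γ) : Free (ℕ ⊕ W) ≃ Free (ℕ ⊕ W) :=
  map (Equiv.sumCongr (Equiv.refl ℕ) σ.toEquiv)

theorem lev_act (σ : Γ ≃g Γ) (v : Free (ℕ ⊕ W)) : lev (act σ v) = lev v := lev_map _ v

theorem rel_act (σ : Γ ≃g Γ) (u v : Free (ℕ ⊕ W)) :
    Rel (rayRel Γ) (act σ u) (act σ v) ↔ Rel (rayRel Γ) u v :=
  rel_map (rayRel_sumCongr Γ σ) u v

theorem rel'_act (σ : Γ ≃g Γ) (S : Set ℕ) (u v : Free (ℕ ⊕ W)) :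
    Rel' (rayRel Γ) S (act σ u) (act σ v) ↔ Rel' (rayRel Γ) S u v :=
  rel'_map (rayRel_sumCongr Γ σ) S u v

theorem act_mul (σ τ : Γ ≃g Γ) (v : Free (ℕ ⊕ W)) : act (σ * τ) v = act σ (act τ v) := by
  refine eqOn_of_base (r := rayRel Γ) (φ := act (σ * τ)) (ψ := (act τ).trans (act σ)) (lev_act _)
    (fun v => ?_) (rel_act _) (fun u v => ?_) (fun b => ?_) v
  · simp [lev_act]
  · simp [rel_act]
  · rcases b with i | w <;> rfl

theorem act_one (v : Free (ℕ ⊕ W)) : act (1 : Γ ≃g Γ) v = v := by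
  refine eqOn_of_base (r := rayRel Γ) (φ := act 1) (ψ := Equiv.refl _) (lev_act _)
    (fun v => rfl) (rel_act _) (fun u v => Iff.rfl) (fun b => ?_) v
  rcases b with i | w <;> rfl

theorem act_injective {σ τ : Γ ≃g Γ} (h : ∀ v, act σ v = act τ v) : σ = τ := by
  refine RelIso.ext fun w => ?_
  exact Sum.inr_injective (base_injective (h (base (.inr w))))

theorem exists_act {φ : Free (ℕ ⊕ W) ≃ Free (ℕ ⊕ W)}
    (h : ∀ u v, Rel (rayRel Γ) (φ u) (φ v) ↔ Rel (rayRel Γ) u v)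
    (h' : ∀ u v, Rel' (rayRel Γ) S (φ u) (φ v) ↔ Rel' (rayRel Γ) S u v) :
    ∃ σ : Γ ≃g Γ, ∀ v, φ v = act σ v := by
  have hlev : ∀ v, lev (φ v) = lev v := lev_eq_of_iso h h'
  have hlev' : ∀ v, lev (φ.symm v) = lev v := fun v => by
    rw [← hlev, φ.apply_symm_apply]
  have hb : ∀ b, ∃ b', base b' = φ (base b) := fun b => exists_base_of_lev_eq_zero (hlev _)
  have hb' : ∀ b, ∃ b', base b' = φ.symm (base b) := fun b => exists_base_of_lev_eq_zero (hlev' _)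
  choose f hf using hb
  choose g hg using hb'
  obtain ⟨σ, hσ⟩ := rayRel_aut Γ (e := ⟨f, g,
    fun b => base_injective (by rw [hg, hf, φ.symm_apply_apply]),
    fun b => base_injective (by rw [hf, hg, φ.apply_symm_apply])⟩) (fun x y => by
      have := h (base x) (base y)
      rwa [← hf, ← hf, rel_base, rel_base] at this)
  refine ⟨σ, eqOn_of_base hlev (lev_act σ) h (rel_act σ) fun b => ?_⟩
  rw [← hf]
  exact congrArg base (hσ b)

/-- The endomorphism of `D` by which an automorphism of `Γ` acts on the right of `f`. -/
def right (c : Coding D Γ S) (σ : Γ ≃g Γ) : D.EndMonoid :=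
  MulOpposite.op ⟨fun x => c.e' (map (act σ) (c.e'.symm x)), fun h => by
    rw [c.e'.map_rel_iff, rel_map (rel'_act σ S)]
    exact c.e'.symm.map_rel_iff.2 h⟩

/-- The endomorphism of `D` by which an automorphism of `Γ` acts on the left of `f`. -/
def left (c : Coding D Γ S) (σ : Γ ≃g Γ) : D.EndMonoid :=
  MulOpposite.op ⟨fun x => c.e.symm (act σ (c.e x)), fun h => by
    rw [c.e.symm.map_rel_iff, rel_act]
    exact c.e.map_rel_iff.2 h⟩

theorem right_apply (c : Coding D Γ S) (σ : Γ ≃g Γ) (x : V) :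
    (c.right σ).unop (c.f.unop x) = c.e' (base (act σ (c.e x))) := by
  rw [c.apply_eq]
  change c.e' (map (act σ) (c.e'.symm (c.e' _))) = _
  rw [RelIso.symm_apply_apply, map_base]

theorem left_apply (c : Coding D Γ S) (σ : Γ ≃g Γ) (x : V) :
    c.f.unop ((c.left σ).unop x) = c.e' (base (act σ (c.e x))) := by
  rw [c.apply_eq]
  change c.e' (base (c.e (c.e.symm _))) = _
  rw [RelIso.apply_symm_apply]

/-- This places the right translates of `f` in its `L`-class. -/
theorem left_mul (c : Coding D Γ S) (σ : Γ ≃g Γ) : c.left σ * c.f = c.f * c.right σ :=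
  EndMonoid.ext fun x => (c.left_apply σ x).trans (c.right_apply σ x).symm

theorem right_mul (c : Coding D Γ S) (σ τ : Γ ≃g Γ) :
    c.f * c.right (σ * τ) = c.f * c.right τ * c.right σ := by
  refine EndMonoid.ext fun x => ?_
  rw [EndMonoid.mul_apply, right_apply, EndMonoid.mul_apply, ← c.left_mul, EndMonoid.mul_apply,
    right_apply, act_mul]
  change _ = c.e' (base (act σ (c.e (c.e.symm _))))
  rw [RelIso.apply_symm_apply]

theorem right_one (c : Coding D Γ S) : c.f * c.right 1 = c.f := by
  refine EndMonoid.ext fun x => ?_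
  rw [EndMonoid.mul_apply, right_apply, act_one, c.apply_eq]

theorem mul_right_mem_hClass (c : Coding D Γ S) (σ : Γ ≃g Γ) : c.f * c.right σ ∈ hClass c.f := by
  have h : c.f * c.right σ * c.right σ⁻¹ = c.f := by
    rw [← right_mul, inv_mul_cancel, right_one]
  have h' : c.f * c.right σ⁻¹ * c.right σ = c.f := by
    rw [← right_mul, mul_inv_cancel, right_one]
  refine ⟨relL_iff.2 ⟨⟨c.left σ⁻¹, ?_⟩, c.left σ, c.left_mul σ⟩,
    relR_iff.2 ⟨⟨_, h⟩, _, rfl⟩⟩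
  rw [← mul_assoc, left_mul, h']

theorem nonempty_schutzenbergerGroup_mulEquiv (c : Coding D Γ S) :
    Nonempty (schutzenbergerGroup c.f ≃* (Γ ≃g Γ)) := by
  refine nonempty_mulEquiv_schutzenbergerGroup c.right c.mul_right_mem_hClass c.right_mul
    (fun σ τ h => act_injective fun v => ?_) (fun t ht => ?_)
  · obtain ⟨x, rfl⟩ := c.e.surjective v
    have := EndMonoid.congr_apply h x
    rw [EndMonoid.mul_apply, right_apply, EndMonoid.mul_apply, right_apply] at this
    exact base_injective (c.e'.injective this)
  · obtain ⟨a, ha, ha', hat⟩ := exists_equiv_of_mem_hClass c.injective ht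
    obtain ⟨σ, hσ⟩ := exists_act (Γ := Γ) (S := S)
      (φ := (c.e.toEquiv.symm.trans a).trans c.e.toEquiv)
      (fun u v => by
        obtain ⟨x, rfl⟩ := c.e.surjective u
        obtain ⟨y, rfl⟩ := c.e.surjective v
        rw [conj_apply, conj_apply, c.e.map_rel_iff, c.e.map_rel_iff, ha])
      (fun u v => by
        obtain ⟨x, rfl⟩ := c.e.surjective u
        obtain ⟨y, rfl⟩ := c.e.surjective v
        rw [conj_apply, conj_apply, ← c.adj_iff, ← c.adj_iff, ha'])
    refine ⟨σ, EndMonoid.ext fun x => ?_⟩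
    rw [EndMonoid.mul_apply, hat, EndMonoid.mul_apply, right_apply, ← hσ, c.apply_eq, conj_apply]

end Coding

end Digraph

/-! ### Counting the `D`-classes. -/

theorem mainTheorem8 {V : Type u} (D : Digraph V) (hD : D.IsCountableUniversal)
    {W : Type v} [Countable W] (Γ : SimpleGraph W) :
    #{C : Set D.EndMonoid // Green.IsDClass C ∧ (∀ f ∈ C, ¬ Green.Regular f) ∧
        ∀ f ∈ C, Nonempty (Green.schutzenbergerGroup f ≃* (Γ ≃g Γ))} = 𝔠 := by
  have := hD.countable
  apply le_antisymm
  -- A `D`-class is determined by a chosen representative.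
  · refine le_trans (Cardinal.mk_le_of_injective (f := fun C => C.2.1.choose) ?_)
      (Digraph.EndMonoid.mk_card_le (D := D))
    intro C C' h
    refine Subtype.ext ?_
    rw [C.2.1.choose_spec, C'.2.1.choose_spec]
    exact congrArg (fun f => {g | Green.RelD f g}) h
  · let c : ∀ S, Digraph.Coding D Γ S := fun S => (hD.nonempty_coding Γ S).some
    let F : Set ℕ → {C : Set D.EndMonoid // Green.IsDClass C ∧ (∀ f ∈ C, ¬ Green.Regular f) ∧
        ∀ f ∈ C, Nonempty (Green.schutzenbergerGroup f ≃* (Γ ≃g Γ))} := fun S =>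
      ⟨{g | Green.RelD (c S).f g}, ⟨_, rfl⟩, fun g hg hreg => (c S).not_regular (hg.regular hreg),
        fun g hg => by
          obtain ⟨e⟩ := Green.RelD.schutzenbergerGroup hg
          obtain ⟨e'⟩ := (c S).nonempty_schutzenbergerGroup_mulEquiv
          exact ⟨e.symm.trans e'⟩⟩
    have hF : Function.Injective F := by
      intro S T h
      have hT : (c T).f ∈ (F T).1 := ⟨_, rfl, rfl⟩
      rw [← h] at hT
      exact (c S).eq_of_relD (c T) hT
    have := Cardinal.mk_le_of_injective (hF.comp ULift.down_injective.{0, u})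
    simpa using this
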